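/- Let $A$ be a simple infinite-dimensional C*-algebra, not necessarily unital, and let $\alpha\colon G\to\operatorname{Aut}(A)$ be an action of a finite group $G$ on $A$ with the weak tracial Rokhlin property. Let $A^\alpha=\{c\in A:\alpha_g(c)=c \text{ for all } g\in G\}$ be the fixed point algebra. Let $a,b\in (A^\alpha)_+$ and assume that $0$ is a limit point of the spectrum $\operatorname{sp}(b)$. Then $a\precsim_A b$ if and only if $a\precsim_{A^\alpha} b$. Here, for a C*-algebra $B$ and $a,b\in B_+$, $a\precsim_B b$ (Cuntz subequivalence in $B$) means that there is a sequence $(w_n)_{n\ge 1}$ in $B$ with $\lim_{n\to\infty} w_n b w_n^*=a$. The action $\alpha$ has the weak tracial Rokhlin property if for every $\varepsilon>0$, every finite set $F\subset A$, and all positive $x,y\in A$ with $\|x\|=1$, there are mutually orthogonal positive contractions $f_g\in A$, for $g\in G$, such that, with $f=\sum_{g\in G}f_g$: (1) $\|cf_g-f_gc\|<\varepsilon$ for all $g\in G$ and $c\in F$; (2) $\|\alpha_g(f_h)-f_{gh}\|<\varepsilon$ for all $g,h\in G$; (3) $(y^2-yfy-\varepsilon)_+\precsim_A x$; (4) $\|fxf\|>1-\varepsilon$.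 For positive $c\in A$ and $\varepsilon>0$, $(c-\varepsilon)_+$ denotes $k(c)$ with $k(t)=\max(0,t-\varepsilon)$, by functional calculus. -/

import Mathlib

open Filter Topology

/-- A C*-algebra is simple if it is nonzero and its only closed two-sided ideals are zero and
the whole algebra. -/
def IsSimpleCStarAlgebra (A : Type*) [NonUnitalCStarAlgebra A] : Prop :=
  Nontrivial A ∧ ∀ I : Submodule ℂ A, IsClosed (I : Set A) →
    (∀ a x : A, x ∈ I → a * x ∈ I ∧ x * a ∈ I) → I = ⊥ ∨ I = ⊤

/-- Cuntz subequivalence `a ≾ b` relative to the C*-algebra `B`, for elements of `B`: there are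
`w₀, w₁, …` in `B` itself with `wₙ b wₙ* → a`. -/
def CuntzSubeq {B : Type*} [NonUnitalCStarAlgebra B] (a b : B) : Prop :=
  ∃ w : ℕ → B, Tendsto (fun n => w n * b * star (w n)) atTop (𝓝 a)

/-- The element `(a - ε)₊`, that is, `f(a)` with `f(t) = max (t - ε) 0`, by the (non-unital)
continuous functional calculus. It is used only for `a ≥ 0` and `ε > 0`. -/
noncomputable def cutDown {A : Type*} [NonUnitalCStarAlgebra A] (a : A) (ε : ℝ) : A :=
  cfcₙ (fun t : ℝ => max (t - ε) 0) a

section Action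

variable {A : Type*} [NonUnitalCStarAlgebra A] {G : Type*} [Group G]

/-- The fixed point algebra `A^α` of an action `α : G → Aut(A)` by *-automorphisms. -/
def fixedPointAlgebra (α : G →* (A ≃⋆ₐ[ℂ] A)) : NonUnitalStarSubalgebra ℂ A where
  carrier := {a | ∀ g, α g a = a}
  add_mem' ha hb g := by rw [map_add, ha g, hb g]
  zero_mem' g := map_zero (α g)
  mul_mem' ha hb g := by rw [map_mul, ha g, hb g]
  smul_mem' c a ha g := by rw [map_smul, ha g]
  star_mem' ha g := by rw [map_star, ha g]

/-- The fixed point algebra is closed; hence it is itself a C*-algebra. -/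
instance fixedPointAlgebra.isClosed (α : G →* (A ≃⋆ₐ[ℂ] A)) :
    IsClosed (fixedPointAlgebra α : Set A) := by
  have h : (fixedPointAlgebra α : Set A) = ⋂ g, {a | α g a = a} := by
    ext a
    rw [Set.mem_iInter]
    rfl
  rw [h]
  exact isClosed_iInter fun g => isClosed_eq (StarAlgEquiv.isometry (α g)).continuous continuous_id

/-- The weak tracial Rokhlin property for an action of a finite group on a (simple, not
necessarily unital) C*-algebra. -/
def WeakTracialRokhlin [Fintype G] [PartialOrder A] [StarOrderedRing A]
    (α : G →* (A ≃⋆ₐ[ℂ] A)) : Prop :=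
  ∀ ε : ℝ, 0 < ε → ∀ F : Finset A, ∀ x y : A, 0 ≤ x → 0 ≤ y → ‖x‖ = 1 →
    ∃ f : G → A,
      (∀ g, 0 ≤ f g ∧ ‖f g‖ ≤ 1) ∧
      (∀ g h, g ≠ h → f g * f h = 0) ∧
      (∀ g, ∀ a ∈ F, ‖a * f g - f g * a‖ < ε) ∧
      (∀ g h, ‖α g (f h) - f (g * h)‖ < ε) ∧
      CuntzSubeq (cutDown (y * y - y * (∑ g, f g) * y) ε) x ∧
      1 - ε < ‖(∑ g, f g) * x * (∑ g, f g)‖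

end Action

/-! ### Cuntz subequivalence: formal properties -/

section Cuntz

variable {A : Type*} [NonUnitalCStarAlgebra A]

/-! Only the passage from `A` to `A^α` needs work. Since `0` is a limit point of `sp(b)`, functional
calculus cuts `b` into an invariant piece `b₁` close to `b` and an orthogonal invariant piece `d²`
with `‖d‖ = 1` (`exists_orthogonal_splitting`). The piece `b₁` carries most of `a`; `d²` absorbs the
remainder.

If `v b₁ v* ≈ a` and `f_g` is a Rokhlin tower with sum `F`, then the invariant element `w = ∑
α_g(f_1 v)` satisfies `w b₁ w* ≈ a^{1/2} F² a^{1/2}`: off-diagonal entries die by orthogonality and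
approximate centrality. As `1 - F² ≤ 2(1 - F)`, condition (3) makes the remainder, after a cut-down,
subequivalent in `A` to a prescribed `x`.

The crux is choosing `x` so that every invariant `r ≾ x` in `A` is already `≾ d²` in `A^α`
(`WeakTracialRokhlin.exists_forall_cuntzSubeq`). Take `x` from a `y = d z z* d` almost orthogonal to
its translates. Averaging `v x v*` over the group is then dominated by a multiple of `(T d)(T d)*`
with `T` invariant, and the off-diagonal errors are absorbed whatever the size of `v`.

Together this gives `a ≤ W b W* + e` in `A^α` with `e` small, and `cutDown_cuntzSubeq_of_le_add`
turns it into subequivalence. -/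

theorem cuntzSubeq_iff_mem_closure {a b : A} :
    CuntzSubeq a b ↔ a ∈ closure (Set.range fun w : A => w * b * star w) := by
  rw [mem_closure_iff_seq_limit]
  constructor
  · rintro ⟨w, hw⟩
    exact ⟨_, fun n => ⟨w n, rfl⟩, hw⟩
  · rintro ⟨x, hx, hlim⟩
    choose w hw using hx
    exact ⟨w, by simpa only [hw] using hlim⟩

theorem cuntzSubeq_iff_forall_norm_le {a b : A} :
    CuntzSubeq a b ↔ ∀ ε : ℝ, 0 < ε → ∃ w : A, ‖a - w * b * star w‖ ≤ ε := by
  rw [cuntzSubeq_iff_mem_closure, Metric.mem_closure_iff]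
  simp only [Set.exists_range_iff, dist_eq_norm]
  constructor
  · intro h ε hε
    obtain ⟨w, hw⟩ := h ε hε
    exact ⟨w, hw.le⟩
  · intro h ε hε
    obtain ⟨w, hw⟩ := h (ε / 2) (half_pos hε)
    exact ⟨w, hw.trans_lt (half_lt_self hε)⟩

theorem CuntzSubeq.trans {a b c : A} (hab : CuntzSubeq a b) (hbc : CuntzSubeq b c) :
    CuntzSubeq a c := by
  rw [cuntzSubeq_iff_mem_closure] at *
  refine closure_minimal ?_ isClosed_closure hab
  rintro _ ⟨w, rfl⟩
  have hcont : Continuous fun x : A => w * x * star w := by fun_prop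
  refine map_mem_closure (f := fun x : A => w * x * star w) hcont hbc ?_
  rintro _ ⟨v, rfl⟩
  exact ⟨w * v, by simp only [star_mul, mul_assoc]⟩

theorem cuntzSubeq_conjugate (w b : A) : CuntzSubeq (w * b * star w) b :=
  ⟨fun _ => w, tendsto_const_nhds⟩

theorem CuntzSubeq.of_tendsto {a b : A} {x : ℕ → A} (hx : Tendsto x atTop (𝓝 a))
    (h : ∀ n, CuntzSubeq (x n) b) : CuntzSubeq a b := by
  simp only [cuntzSubeq_iff_mem_closure] at *
  exact isClosed_closure.mem_of_tendsto hx (Eventually.of_forall h)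

theorem norm_cfcₙ_clamp_le (a : A) {ε : ℝ} (hε : 0 ≤ ε) :
    ‖cfcₙ (fun t : ℝ => max (min t ε) 0) a‖ ≤ ε := by
  refine norm_cfcₙ_le fun t _ => ?_
  rw [Real.norm_of_nonneg (le_max_right _ _)]
  exact max_le (min_le_right _ _) hε

end Cuntz

/-! ### From order relations to Cuntz subequivalence -/

section Order

variable {A : Type*} [NonUnitalCStarAlgebra A] [PartialOrder A] [StarOrderedRing A]

/-- With `m = q/(q+κ)`, formally `(1-m) p (1-m) ≤ (1-m) q (1-m)`, and the right side is the function
`tκ²/(t+κ)² ≤ κ` of `q`. So `m` acts as an approximate unit for `s`, and it is built from `q` alone.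
-/
theorem norm_sub_mul_cfcₙ_le {p q s : A} (hs : star s * s = p) (hpq : p ≤ q) (hq : 0 ≤ q) {κ : ℝ}
    (hκ : 0 < κ) : ‖s - s * cfcₙ (fun t : ℝ => t / (t + κ)) q‖ ^ 2 ≤ κ := by
  have hσ : ∀ t ∈ quasispectrum ℝ q, 0 ≤ t := quasispectrum_nonneg_of_nonneg q hq
  have hc : ContinuousOn (fun t : ℝ => t / (t + κ)) (quasispectrum ℝ q) :=
    continuousOn_id.div (by fun_prop) fun t ht => by have := hσ t ht; positivity
  set m := cfcₙ (fun t : ℝ => t / (t + κ)) q with hm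
  have hmsa : star m = m := IsSelfAdjoint.cfcₙ
  obtain ⟨d, hd⟩ := CStarAlgebra.nonneg_iff_eq_star_mul_self.1 (sub_nonneg.2 hpq)
  have hle : star (s - s * m) * (s - s * m) ≤ q - q * m - m * q + m * q * m := by
    rw [← sub_nonneg]
    have h0 := star_mul_self_nonneg (d - d * m)
    have hd' : star d * d = q - star s * s := by rw [← hd, hs]
    have e1 : star (d - d * m) * (d - d * m)
        = star d * d - star d * d * m - m * (star d * d) + m * (star d * d) * m := by
      simp only [star_sub, star_mul, hmsa]; noncomm_ring
    have e2 : star (s - s * m) * (s - s * m)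
        = star s * s - star s * s * m - m * (star s * s) + m * (star s * s) * m := by
      simp only [star_sub, star_mul, hmsa]; noncomm_ring
    rw [e1, hd'] at h0
    rw [e2]
    convert h0 using 1
    noncomm_ring
  have heq : q - q * m - m * q + m * q * m
      = cfcₙ (fun t : ℝ => t - t * (t / (t + κ)) - (t / (t + κ)) * t
          + (t / (t + κ)) * t * (t / (t + κ))) q := by
    have hid : cfcₙ (fun t : ℝ => t) q = q := cfcₙ_id' ℝ q
    have hc2 : ContinuousOn (fun t : ℝ => t * (t / (t + κ))) (quasispectrum ℝ q) :=
      continuousOn_id.mul hc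
    have hc3 : ContinuousOn (fun t : ℝ => (t / (t + κ)) * t) (quasispectrum ℝ q) :=
      hc.mul continuousOn_id
    have hc4 : ContinuousOn (fun t : ℝ => (t / (t + κ)) * t * (t / (t + κ)))
        (quasispectrum ℝ q) := hc3.mul hc
    rw [cfcₙ_add (fun t : ℝ => t - t * (t / (t + κ)) - (t / (t + κ)) * t) _ q
        ((continuousOn_id.sub hc2).sub hc3) (by simp) hc4 (by simp),
      cfcₙ_sub (fun t : ℝ => t - t * (t / (t + κ))) _ q (continuousOn_id.sub hc2) (by simp)
        hc3 (by simp),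
      cfcₙ_sub (fun t : ℝ => t) _ q continuousOn_id (by simp) hc2 (by simp),
      cfcₙ_mul _ (fun t : ℝ => t / (t + κ)) q hc3 (by simp) hc (by simp),
      cfcₙ_mul (fun t : ℝ => t) _ q continuousOn_id (by simp) hc (by simp),
      cfcₙ_mul _ (fun t : ℝ => t) q hc (by simp) continuousOn_id (by simp), hid]
  have hnorm : ‖s - s * m‖ ^ 2 = ‖star (s - s * m) * (s - s * m)‖ := by
    rw [CStarRing.norm_star_mul_self, sq]
  rw [hnorm]
  refine (CStarAlgebra.norm_le_norm_of_nonneg_of_le (star_mul_self_nonneg _) hle).trans ?_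
  rw [heq]
  refine norm_cfcₙ_le fun t ht => ?_
  have ht0 := hσ t ht
  have : t - t * (t / (t + κ)) - (t / (t + κ)) * t + (t / (t + κ)) * t * (t / (t + κ))
      = t * κ * κ / ((t + κ) * (t + κ)) := by field_simp; ring
  rw [this, Real.norm_of_nonneg (by positivity), div_le_iff₀ (by positivity)]
  have h1 : 0 ≤ κ * (t * t) := by positivity
  have h2 : 0 ≤ t * κ * κ := by positivity
  have h3 : 0 ≤ κ * κ * κ := by positivity
  nlinarith

theorem CuntzSubeq.of_le {p q : A} (hp : 0 ≤ p) (hpq : p ≤ q) : CuntzSubeq p q := by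
  have hq := hp.trans hpq
  set s := CFC.sqrt p
  have hss : s * s = p := CFC.sqrt_mul_sqrt_self p
  have hsa : star s = s := (IsSelfAdjoint.of_nonneg (CFC.sqrt_nonneg p)).star_eq
  set m : ℕ → A := fun n => cfcₙ (fun t : ℝ => t / (t + 1 / ((n : ℝ) + 1))) q
  have hm : Tendsto (fun n => s * m n) atTop (𝓝 s) := by
    rw [tendsto_iff_norm_sub_tendsto_zero]
    have hlim : Tendsto (fun n : ℕ => √(1 / ((n : ℝ) + 1))) atTop (𝓝 0) := by
      have := (Real.continuous_sqrt.tendsto 0).comp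
        (tendsto_one_div_add_atTop_nhds_zero_nat (𝕜 := ℝ))
      rwa [Real.sqrt_zero] at this
    refine squeeze_zero (fun _ => norm_nonneg _) (fun n => ?_) hlim
    rw [norm_sub_rev]
    exact Real.le_sqrt_of_sq_le (norm_sub_mul_cfcₙ_le (by rw [hsa, hss]) hpq hq (by positivity))
  have hlim : Tendsto (fun n => s * m n * star (s * m n)) atTop (𝓝 p) := by
    have := hm.mul hm.star
    rwa [hsa, hss] at this
  refine CuntzSubeq.of_tendsto hlim fun n => ?_
  have hκ : 0 < 1 / ((n : ℝ) + 1) := by positivity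
  set κ := 1 / ((n : ℝ) + 1)
  have hσ : ∀ t ∈ quasispectrum ℝ q, 0 ≤ t := quasispectrum_nonneg_of_nonneg q hq
  have hc : ContinuousOn (fun t : ℝ => √t / (t + κ)) (quasispectrum ℝ q) :=
    Real.continuous_sqrt.continuousOn.div (by fun_prop) fun t ht => by
      have := hσ t ht; positivity
  -- Chosen so that `u q u = m²`, which rewrites `s m² s` as a conjugate of `q`.
  set u := cfcₙ (fun t : ℝ => √t / (t + κ)) q
  have husa : star u = u := IsSelfAdjoint.cfcₙ
  have hc' : ContinuousOn (fun t : ℝ => t / (t + κ)) (quasispectrum ℝ q) :=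
    continuousOn_id.div (by fun_prop) fun t ht => by have := hσ t ht; positivity
  have hmu : m n * m n = u * q * u := by
    have hid : cfcₙ (fun t : ℝ => t) q = q := cfcₙ_id' ℝ q
    have : u * q * u = cfcₙ (fun t : ℝ => √t / (t + κ) * t * (√t / (t + κ))) q := by
      rw [cfcₙ_mul (fun t : ℝ => √t / (t + κ) * t) (fun t : ℝ => √t / (t + κ)) q
        (hc.mul continuousOn_id) (by simp) hc (by simp),
        cfcₙ_mul _ (fun t : ℝ => t) q hc (by simp) continuousOn_id (by simp), hid]
    rw [this, ← cfcₙ_mul (fun t : ℝ => t / (t + κ)) (fun t : ℝ => t / (t + κ)) q hc' (by simp)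
      hc' (by simp)]
    refine cfcₙ_congr fun t ht => ?_
    have h1 := Real.mul_self_sqrt (hσ t ht)
    have h2 := hσ t ht
    have : t + κ ≠ 0 := by positivity
    field_simp
    rw [sq √t, h1]
    ring
  have hmsa : star (m n) = m n := IsSelfAdjoint.cfcₙ
  have : s * m n * star (s * m n) = (s * u) * q * star (s * u) := by
    rw [star_mul, star_mul, hmsa, husa, mul_assoc, ← mul_assoc (m n), hmu]
    simp only [mul_assoc]
  rw [this]
  exact cuntzSubeq_conjugate _ _

/-- Conjugation by `l⁻¹` would do; `l/(l² + η²)` is its regularisation and costs an error of at most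
`η`. -/
theorem cuntzSubeq_mul_self_mul_self {l : A} (hl : 0 ≤ l) : CuntzSubeq l (l * l * l) := by
  rw [cuntzSubeq_iff_forall_norm_le]
  intro η hη
  have hσ : ∀ t ∈ quasispectrum ℝ l, 0 ≤ t := quasispectrum_nonneg_of_nonneg l hl
  have hc : Continuous (fun t : ℝ => t / (t * t + η * η)) :=
    continuous_id.div (by fun_prop) fun t =>
      (add_pos_of_nonneg_of_pos (mul_self_nonneg t) (mul_pos hη hη)).ne'
  have hc2 : Continuous (fun t : ℝ => t / (t * t + η * η) * (t * t * t)) :=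
    hc.mul (by fun_prop)
  have hc3 : Continuous (fun t : ℝ => t / (t * t + η * η) * (t * t * t) *
      (t / (t * t + η * η))) := hc2.mul hc
  set u := cfcₙ (fun t : ℝ => t / (t * t + η * η)) l
  have husa : star u = u := IsSelfAdjoint.cfcₙ
  refine ⟨u, ?_⟩
  have hid : cfcₙ (fun t : ℝ => t) l = l := cfcₙ_id' ℝ l
  have : l - u * (l * l * l) * star u = cfcₙ (fun t : ℝ => t - t / (t * t + η * η) * (t * t * t)
      * (t / (t * t + η * η))) l := by
    rw [cfcₙ_sub (fun t : ℝ => t) _ l (by fun_prop) (by simp) hc3.continuousOn (by simp),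
      cfcₙ_mul (fun t : ℝ => t / (t * t + η * η) * (t * t * t)) (fun t : ℝ => t / (t * t + η * η)) l
        hc2.continuousOn (by simp) hc.continuousOn (by simp),
      cfcₙ_mul (fun t : ℝ => t / (t * t + η * η)) (fun t : ℝ => t * t * t) l
        hc.continuousOn (by simp) (by fun_prop) (by simp),
      cfcₙ_mul (fun t : ℝ => t * t) (fun t : ℝ => t) l
        (by fun_prop) (by simp) (by fun_prop) (by simp),
      cfcₙ_mul (fun t : ℝ => t) (fun t : ℝ => t) l
        (by fun_prop) (by simp) (by fun_prop) (by simp), hid, husa]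
  rw [this]
  refine norm_cfcₙ_le fun t ht => ?_
  have ht0 := hσ t ht
  have hpos : 0 < t * t + η * η := by positivity
  have e : t - t / (t * t + η * η) * (t * t * t) * (t / (t * t + η * η))
      = t * (2 * (t * t) * (η * η) + η * η * (η * η)) / ((t * t + η * η) * (t * t + η * η)) := by
    field_simp
    ring
  rw [e, Real.norm_of_nonneg (by positivity), div_le_iff₀ (by positivity)]
  have h1 : 0 ≤ η * (t * t - t * η) ^ 2 := by positivity
  have h2 : 0 ≤ (η * η * η) * (t - η / 2) ^ 2 := by positivity
  have h3 : 0 ≤ (η * η * η) * (t * t) := by positivity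
  have h4 : 0 ≤ η ^ 5 := by positivity
  nlinarith

theorem cutDown_nonneg (a : A) (ε : ℝ) : 0 ≤ cutDown a ε :=
  cfcₙ_nonneg fun _ _ => le_max_right _ _

theorem norm_sub_cutDown_le {a : A} (ha : 0 ≤ a) {ε : ℝ} (hε : 0 ≤ ε) :
    ‖a - cutDown a ε‖ ≤ ε := by
  have hid : cfcₙ (fun t : ℝ => t) a = a := cfcₙ_id' ℝ a
  have : a - cutDown a ε = cfcₙ (fun t : ℝ => t - max (t - ε) 0) a := by
    rw [cfcₙ_sub (fun t : ℝ => t) _ a (by fun_prop) (by simp) (by fun_prop) (by simp [hε]), hid,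
      cutDown]
  rw [this]
  refine norm_cfcₙ_le fun t ht => ?_
  have := quasispectrum_nonneg_of_nonneg a ha t ht
  rw [Real.norm_eq_abs, abs_le]
  rcases max_cases (t - ε) 0 with h | h <;> constructor <;> linarith [h.1, h.2]

/-- Truncating the clamp at `0` discards the negative part, so self-adjointness suffices and the
clamp still has norm at most `ε`. -/
theorem le_cutDown_add_cfcₙ_clamp {a : A} (ha : IsSelfAdjoint a) {ε : ℝ} (hε : 0 ≤ ε) :
    a ≤ cutDown a ε + cfcₙ (fun t : ℝ => max (min t ε) 0) a := by
  have hid : cfcₙ (fun t : ℝ => t) a = a := cfcₙ_id' ℝ a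
  rw [cutDown, ← cfcₙ_add _ _ a (by fun_prop) (by simp [hε]) (by fun_prop) (by simp [hε])]
  conv_lhs => rw [← hid]
  refine cfcₙ_mono (fun t _ => ?_) (by fun_prop) (by fun_prop) (by simp) (by simp [hε])
  rcases le_total t ε with h | h
  · exact (le_max_left t 0).trans (by rw [min_eq_left h]; linarith [le_max_right (t - ε) 0])
  · have := le_max_left ε 0
    rw [min_eq_right h]
    linarith [le_max_left (t - ε) 0]

/-- For `l = (p-ε)₊` one has `l p l = l³ + ε l²`, while conjugating the hypothesis gives `l p l ≤ l
q l + ε l²`. Hence `l ≾ l³ ≾ l q l ≾ q`. Positivity of `p` plays no role, so this applies to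
differences. -/
theorem cutDown_cuntzSubeq_of_le_add {p q e : A} (hp : IsSelfAdjoint p) (hq : 0 ≤ q) {ε : ℝ}
    (hpq : p ≤ q + e) (he : ‖e‖ ≤ ε) : CuntzSubeq (cutDown p ε) q := by
  have hε : 0 ≤ ε := (norm_nonneg e).trans he
  have hl := cutDown_nonneg p ε
  set l := cutDown p ε with hldef
  have hlsa : star l = l := (IsSelfAdjoint.of_nonneg hl).star_eq
  have hesa : IsSelfAdjoint e := by
    have := (IsSelfAdjoint.of_nonneg (sub_nonneg.2 hpq)).sub (IsSelfAdjoint.of_nonneg hq)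
    have := this.add hp
    convert this using 1
    abel
  have h1 : l * p * l ≤ l * q * l + ε • (l * l) := by
    have h2 := star_left_conjugate_le_conjugate hpq l
    have h3 := CStarAlgebra.star_left_conjugate_le_norm_smul (a := l) hesa
    rw [hlsa] at h2 h3
    refine h2.trans ?_
    rw [mul_add, add_mul]
    gcongr
    refine h3.trans ?_
    have : 0 ≤ l * l := by simpa [hlsa] using star_mul_self_nonneg l
    gcongr
  have h2 : l * p * l = l * l * l + ε • (l * l) := by
    have hid : cfcₙ (fun t : ℝ => t) p = p := cfcₙ_id' ℝ p
    have hc : ContinuousOn (fun t : ℝ => max (t - ε) 0) (quasispectrum ℝ p) := by fun_prop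
    have h0 : (fun t : ℝ => max (t - ε) 0) 0 = 0 := by simp [hε]
    have e1 : l * l = cfcₙ (fun t : ℝ => max (t - ε) 0 * max (t - ε) 0) p :=
      (cfcₙ_mul _ _ p hc h0 hc h0).symm
    have e2 : l * l * l = cfcₙ (fun t : ℝ => max (t - ε) 0 * max (t - ε) 0 * max (t - ε) 0) p := by
      rw [e1, hldef, cutDown, ← cfcₙ_mul (fun t : ℝ => max (t - ε) 0 * max (t - ε) 0) _ p
        (hc.mul hc) (by simp [hε]) hc h0]
    have e3 : l * p * l = cfcₙ (fun t : ℝ => max (t - ε) 0 * t * max (t - ε) 0) p := by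
      rw [cfcₙ_mul (fun t : ℝ => max (t - ε) 0 * t) _ p (hc.mul continuousOn_id) (by simp) hc h0,
        cfcₙ_mul (fun t : ℝ => max (t - ε) 0) (fun t : ℝ => t) p hc h0 continuousOn_id (by simp),
        hid, hldef, cutDown]
    rw [e2, e3, e1, ← cfcₙ_smul ε (fun t : ℝ => max (t - ε) 0 * max (t - ε) 0) p (hc.mul hc)
      (by simp [hε]), ← cfcₙ_add (fun t : ℝ => max (t - ε) 0 * max (t - ε) 0 * max (t - ε) 0)
      (fun t : ℝ => ε • (max (t - ε) 0 * max (t - ε) 0)) p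
      ((hc.mul hc).mul hc) (by simp [hε]) ((hc.mul hc).const_smul ε) (by simp [hε])]
    refine cfcₙ_congr fun t _ => ?_
    simp only [smul_eq_mul]
    rcases max_cases (t - ε) 0 with h | h
    · rw [h.1]; ring
    · rw [h.1]; ring
  rw [h2] at h1
  have h3 : l * l * l ≤ l * q * l := le_of_add_le_add_right h1
  have h4 : 0 ≤ l * l * l := by
    simpa [hlsa] using star_left_conjugate_nonneg hl l
  refine (cuntzSubeq_mul_self_mul_self hl).trans ((CuntzSubeq.of_le h4 h3).trans ?_)
  have := cuntzSubeq_conjugate l q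
  rwa [hlsa] at this

end Order

/-! ### The fixed point algebra as an ordered C*-algebra -/

section FixedPoint

variable {A : Type*} [NonUnitalCStarAlgebra A] {G : Type*} [Group G]

theorem cfcₙ_mem_fixedPointAlgebra (α : G →* (A ≃⋆ₐ[ℂ] A)) (f : ℝ → ℝ) {a : A}
    (ha : a ∈ fixedPointAlgebra α) : cfcₙ f a ∈ fixedPointAlgebra α :=
  cfcₙ_mem (𝕜' := ℂ) f ha

theorem sum_mem_fixedPointAlgebra [Fintype G] (α : G →* (A ≃⋆ₐ[ℂ] A)) (x : A) :
    ∑ g, α g x ∈ fixedPointAlgebra α := by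
  intro h
  rw [map_sum]
  refine Fintype.sum_equiv (Equiv.mulLeft h) _ _ fun g => ?_
  rw [Equiv.coe_mulLeft, map_mul]
  rfl

theorem CuntzSubeq.coe {α : G →* (A ≃⋆ₐ[ℂ] A)} {a b : fixedPointAlgebra α}
    (h : CuntzSubeq a b) : CuntzSubeq (a : A) (b : A) := by
  obtain ⟨w, hw⟩ := h
  exact ⟨fun n => w n, (continuous_subtype_val.tendsto a).comp hw⟩

/-- The square root of an invariant positive element is invariant, so the order inherited from `A`
is the intrinsic one. This lets the comparison lemmas be applied inside `A^α`. -/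
instance fixedPointAlgebra.starOrderedRing [PartialOrder A] [StarOrderedRing A]
    (α : G →* (A ≃⋆ₐ[ℂ] A)) : StarOrderedRing (fixedPointAlgebra α) := by
  refine StarOrderedRing.of_nonneg_iff' (fun {x y} hxy z => ?_) fun x => ⟨fun hx => ?_, ?_⟩
  · exact add_le_add_right (show (x : A) ≤ y from hxy) (z : A)
  · have hx' : 0 ≤ (x : A) := hx
    have hs : CFC.sqrt (x : A) ∈ fixedPointAlgebra α := by
      rw [CFC.sqrt_eq_real_sqrt (x : A)]
      exact cfcₙ_mem_fixedPointAlgebra α _ x.2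
    refine ⟨⟨_, hs⟩, Subtype.ext ?_⟩
    have hsa : star (CFC.sqrt (x : A)) = CFC.sqrt (x : A) :=
      (IsSelfAdjoint.of_nonneg (CFC.sqrt_nonneg _)).star_eq
    change (x : A) = star (CFC.sqrt (x : A)) * CFC.sqrt (x : A)
    rw [hsa, CFC.sqrt_mul_sqrt_self (x : A) hx']
  · rintro ⟨s, rfl⟩
    exact star_mul_self_nonneg (s : A)

end FixedPoint

/-! ### Sums of almost orthogonal conjugates -/

section Rokhlin

variable {A : Type*} [NonUnitalCStarAlgebra A] [PartialOrder A] [StarOrderedRing A]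

/-- Young's inequality for an off-diagonal term. -/
theorem neg_smul_le_offDiag {p q E : A} {δ : ℝ} (hδ : 0 < δ) (hE : ‖E‖ ≤ δ) :
    -(δ • (p * star p + q * star q)) ≤ p * E * star q + q * star E * star p := by
  have h1 := mul_star_self_nonneg (δ • p + q * star E)
  have h2 : q * (star E * E) * star q ≤ (δ * δ) • (q * star q) := by
    have h3 := CStarAlgebra.star_right_conjugate_le_norm_smul (a := q) (b := star E * E)
      (IsSelfAdjoint.star_mul_self E)
    refine h3.trans ?_
    rw [CStarRing.norm_star_mul_self]
    have : 0 ≤ q * star q := mul_star_self_nonneg q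
    gcongr
  have h4 : (δ • p + q * star E) * star (δ • p + q * star E)
      = (δ * δ) • (p * star p) + δ • (p * E * star q + q * star E * star p)
        + q * (star E * E) * star q := by
    simp only [star_add, star_smul, star_mul, star_star, star_trivial, add_mul, mul_add,
      smul_mul_assoc, mul_smul_comm, smul_add, smul_smul, mul_assoc]
    abel
  rw [h4] at h1
  have h5 : 0 ≤ δ • (δ • (p * star p + q * star q)
      + (p * E * star q + q * star E * star p)) := by
    refine h1.trans ?_
    have := add_le_add_right h2 ((δ * δ) • (p * star p)
      + δ • (p * E * star q + q * star E * star p))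
    refine this.trans (le_of_eq ?_)
    module
  have h6 := (smul_nonneg_iff_nonneg_of_pos_left hδ).1 h5
  rwa [neg_le_iff_add_nonneg']

/-- Off-diagonal terms are charged to the same `P i * star (P i)` that the diagonal controls, so the
bound does not depend on `‖P i‖`. -/
theorem smul_sum_mul_star_le {ι : Type*} [Fintype ι] [DecidableEq ι] (P Y : ι → A) {η δ : ℝ}
    (hδ : 0 < δ) (hη : ∀ i, η • (P i * star (P i)) ≤ P i * (Y i * star (Y i)) * star (P i))
    (hY : ∀ i j, i ≠ j → ‖Y i * star (Y j)‖ ≤ δ) :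
    (η - Fintype.card ι * δ) • ∑ i, P i * star (P i)
      ≤ (∑ i, P i * Y i) * star (∑ i, P i * Y i) := by
  -- The entries are symmetrised, so the double sum counts everything twice; the factor 2 is
  -- cancelled at the end.
  have key : ∀ i j, (if i = j then (2 * η) • (P i * star (P i)) else 0)
      - δ • (P i * star (P i) + P j * star (P j))
      ≤ P i * (Y i * star (Y j)) * star (P j) + P j * (Y j * star (Y i)) * star (P i) := by
    intro i j
    have hpos : ∀ k, 0 ≤ P k * star (P k) := fun k => mul_star_self_nonneg _
    split_ifs with h
    · subst h
      rw [two_mul, add_smul]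
      refine (sub_le_self _ ?_).trans (add_le_add (hη i) (hη i))
      have := add_nonneg (hpos i) (hpos i)
      positivity
    · have := neg_smul_le_offDiag (p := P i) (q := P j) hδ (hY i j h)
      simpa [star_mul] using this
  have hsum := Finset.sum_le_sum fun i (_ : i ∈ Finset.univ) =>
    Finset.sum_le_sum fun j (_ : j ∈ Finset.univ) => key i j
  have hW : (∑ i, P i * Y i) * star (∑ i, P i * Y i)
      = ∑ i, ∑ j, P i * (Y i * star (Y j)) * star (P j) := by
    rw [star_sum, Finset.sum_mul_sum]
    simp only [star_mul, mul_assoc]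
  simp only [Finset.sum_add_distrib, Finset.sum_sub_distrib, Finset.sum_ite_eq, Finset.mem_univ,
    if_true] at hsum
  rw [Finset.sum_comm (f := fun i j => P j * (Y j * star (Y i)) * star (P i)), ← hW,
    ← two_smul ℝ ((∑ i, P i * Y i) * _)] at hsum
  have h2 : (2 : ℝ) • ((η - Fintype.card ι * δ) • ∑ i, P i * star (P i))
      ≤ (2 : ℝ) • ((∑ i, P i * Y i) * star (∑ i, P i * Y i)) := by
    refine le_trans (le_of_eq ?_) hsum
    simp only [smul_add, Finset.sum_add_distrib, Finset.sum_const, Finset.card_univ,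
      ← Finset.smul_sum, ← Nat.cast_smul_eq_nsmul ℝ]
    module
  exact (smul_le_smul_iff_of_pos_left two_pos).1 h2

/-! ### Room below an invariant element -/

variable {G : Type*} [Group G] [Fintype G]

theorem norm_starAlgEquiv_apply (φ : A ≃⋆ₐ[ℂ] A) (x : A) : ‖φ x‖ = ‖x‖ := by
  simpa using (StarAlgEquiv.isometry φ).norm_map_of_map_zero (map_zero φ) x

/-- In any action with the weak tracial Rokhlin property, for every invariant positive
`d` of norm one there is `y = d z z* d`, of norm bounded below in terms of the group only, that is
almost orthogonal to its translates. -/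
theorem WeakTracialRokhlin.exists_almost_orthogonal {α : G →* (A ≃⋆ₐ[ℂ] A)}
    (hα : WeakTracialRokhlin α) {d : A} (hd0 : 0 ≤ d) (hdfix : d ∈ fixedPointAlgebra α)
    (hd1 : ‖d‖ = 1) {δ : ℝ} (hδ : 0 < δ) :
    ∃ z : A, 1 / (16 * (Fintype.card G : ℝ) ^ 2) ≤ ‖d * (z * star z) * d‖ ∧
      ∀ g h : G, g ≠ h → ‖α g (d * (z * star z) * d) * α h (d * (z * star z) * d)‖ ≤ δ := by
  classical
  set n : ℝ := (Fintype.card G : ℝ)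
  have hn : 1 ≤ n := Nat.one_le_cast.2 Fintype.card_pos
  have hdsa : star d = d := (IsSelfAdjoint.of_nonneg hd0).star_eq
  obtain ⟨ε, hε, hε1, hε2⟩ : ∃ ε : ℝ, 0 < ε ∧ ε ≤ 1 / (4 * n) ∧ 2 * ε ≤ δ :=
    ⟨min (1 / (4 * n)) (δ / 2), by positivity, min_le_left _ _, by
      linarith [min_le_right (1 / (4 * n)) (δ / 2)]⟩
  have hdd : ‖d * d‖ = 1 := by
    have := CStarRing.norm_star_mul_self (x := d)
    rwa [hdsa, hd1, one_mul] at this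
  have hdd0 : 0 ≤ d * d := by simpa [hdsa] using star_mul_self_nonneg d
  obtain ⟨f, hf1, hf2, hf3, hf4, -, hf6⟩ := hα ε hε {d * d} (d * d) 0 hdd0 le_rfl hdd
  have hfsa : ∀ g, star (f g) = f g := fun g => (IsSelfAdjoint.of_nonneg (hf1 g).1).star_eq
  set F := ∑ g, f g
  have hFsa : star F = F := by simp only [F, star_sum, hfsa]
  have hε4 : ε ≤ 1 / 4 := hε1.trans (by
    rw [div_le_div_iff₀ (by positivity) (by positivity)]; linarith)
  have hdF : 1 / 2 ≤ ‖d * F‖ := by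
    have h1 := CStarRing.norm_star_mul_self (x := d * F)
    rw [star_mul, hdsa, hFsa, show F * d * (d * F) = F * (d * d) * F by simp only [mul_assoc]] at h1
    by_contra! h
    have := norm_nonneg (d * F)
    nlinarith
  -- Some level of the tower carries its share of `‖d F‖ ≥ 1/2`; invariance of `d` then moves this
  -- to level `1`, losing only `ε`.
  obtain ⟨g, hg⟩ : ∃ g, 1 / (2 * n) ≤ ‖d * f g‖ := by
    by_contra! h
    have h1 : ‖d * F‖ < 1 / 2 := by
      rw [Finset.mul_sum]
      refine (norm_sum_le _ _).trans_lt ((Finset.sum_lt_sum_of_nonempty Finset.univ_nonempty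
        fun g _ => h g).trans_eq ?_)
      rw [Finset.sum_const, Finset.card_univ, nsmul_eq_mul]
      change n * _ = _
      field_simp
    linarith
  have hαd : ∀ g, α g d = d := hdfix
  have hz : 1 / (4 * n) ≤ ‖d * f 1‖ := by
    have h1 : ‖d * α g (f 1)‖ = ‖d * f 1‖ := by
      rw [← norm_starAlgEquiv_apply (α g) (d * f 1), map_mul, hαd]
    have h2 : ‖d * f g - d * α g (f 1)‖ ≤ ε := by
      rw [← mul_sub]
      refine (norm_mul_le _ _).trans ?_
      rw [hd1, one_mul, norm_sub_rev]
      simpa using (hf4 g 1).le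
    have h3 := norm_sub_norm_le (d * f g) (d * α g (f 1))
    have h4 : 1 / (2 * n) = 1 / (4 * n) + 1 / (4 * n) := by field_simp; norm_num
    linarith
  have hynorm : ‖d * (f 1 * star (f 1)) * d‖ = ‖d * f 1‖ ^ 2 := by
    rw [sq, ← CStarRing.norm_self_mul_star (x := d * f 1), star_mul, hdsa]
    simp only [mul_assoc]
  refine ⟨f 1, ?_, fun g h hgh => ?_⟩
  · rw [hynorm]
    calc 1 / (16 * n ^ 2) = (1 / (4 * n)) ^ 2 := by field_simp; norm_num
      _ ≤ _ := by gcongr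
  · set y := d * (f 1 * star (f 1)) * d with hy
    set k := g⁻¹ * h with hk
    have hk1 : 1 ≠ k := fun H => hgh (by rw [hk] at H; rw [eq_inv_mul_iff_mul_eq.1 H |>.symm]; simp)
    have h1 : α g y * α h y = α g (y * α k y) := by
      have : α g (α k y) = α h y := by
        have hgk : α h = α g * α k := by rw [← map_mul, hk, mul_inv_cancel_left]
        rw [hgk]
        rfl
      rw [map_mul (α g) y, this]
    rw [h1, norm_starAlgEquiv_apply]
    have h2 : y * α k y = d * f 1 * (f 1 * (d * d) * α k (f 1)) * (α k (f 1) * d) := by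
      simp only [hy, map_mul, hαd, hfsa, mul_assoc]
    -- One `ε` replaces `α k (f 1)` by `f k`, the other commutes `d²` past `f 1`; then `f 1 * f k =
    -- 0`.
    have h3 : ‖f 1 * (d * d) * α k (f 1)‖ ≤ 2 * ε := by
      have e : f 1 * (d * d) * α k (f 1) = f 1 * (d * d) * (α k (f 1) - f k)
          - (d * d * f 1 - f 1 * (d * d)) * f k := by
        have : d * d * f 1 * f k = 0 := by rw [mul_assoc, hf2 1 k hk1, mul_zero]
        rw [mul_sub, sub_mul, this]; abel
      have n1 : ‖f 1 * (d * d) * (α k (f 1) - f k)‖ ≤ ε := by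
        have a1 : ‖f 1 * (d * d)‖ ≤ 1 := (norm_mul_le _ _).trans (by
          rw [hdd, mul_one]; exact (hf1 1).2)
        have a2 : ‖α k (f 1) - f k‖ ≤ ε := by simpa using (hf4 k 1).le
        calc _ ≤ _ := norm_mul_le _ _
          _ ≤ 1 * ε := by gcongr
          _ = ε := one_mul _
      have n2 : ‖(d * d * f 1 - f 1 * (d * d)) * f k‖ ≤ ε := by
        have a1 := (hf3 1 (d * d) (Finset.mem_singleton_self _)).le
        calc _ ≤ _ := norm_mul_le _ _
          _ ≤ ε * 1 := by gcongr; exact (hf1 k).2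
          _ = ε := mul_one _
      rw [e]
      linarith [norm_sub_le (f 1 * (d * d) * (α k (f 1) - f k))
        ((d * d * f 1 - f 1 * (d * d)) * f k)]
    have m1 : ‖d * f 1‖ ≤ 1 := (norm_mul_le _ _).trans (by rw [hd1, one_mul]; exact (hf1 1).2)
    have m2 : ‖α k (f 1) * d‖ ≤ 1 := (norm_mul_le _ _).trans (by
      rw [hd1, mul_one, norm_starAlgEquiv_apply]; exact (hf1 1).2)
    rw [h2]
    calc _ ≤ ‖d * f 1‖ * ‖f 1 * (d * d) * α k (f 1)‖ * ‖α k (f 1) * d‖ :=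
          (norm_mul_le _ _).trans (by gcongr; exact norm_mul_le _ _)
      _ ≤ 1 * (2 * ε) * 1 := by gcongr
      _ ≤ δ := by linarith

/-- Below every nonzero invariant positive element there is room for all invariant elements that
are small enough in the whole algebra. -/
theorem WeakTracialRokhlin.exists_forall_cuntzSubeq {α : G →* (A ≃⋆ₐ[ℂ] A)}
    (hα : WeakTracialRokhlin α) (d : fixedPointAlgebra α) (hd0 : 0 ≤ d) (hd1 : ‖d‖ = 1) :
    ∃ x : A, 0 ≤ x ∧ ‖x‖ = 1 ∧ ∀ r : fixedPointAlgebra α, CuntzSubeq (r : A) x →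
      CuntzSubeq r (d * d) := by
  classical
  set n : ℝ := (Fintype.card G : ℝ) with hn_def
  have hn : 1 ≤ n := Nat.one_le_cast.2 Fintype.card_pos
  -- Half the lower bound for `‖y‖`, so that the cut-down of `y` at `η` is nonzero. The value of `δ`
  -- makes `η² - nδ = η²/2`.
  set η : ℝ := 1 / (32 * n ^ 2) with hη_def
  have hη : 0 < η := by positivity
  set δ : ℝ := η ^ 2 / (2 * n)
  have hδ : 0 < δ := by positivity
  obtain ⟨z, hz1, hz2⟩ := hα.exists_almost_orthogonal (d := (d : A)) hd0 d.2 hd1 hδ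
  have hdsa : star (d : A) = d := (IsSelfAdjoint.of_nonneg (show (0 : A) ≤ d from hd0)).star_eq
  have hdfix : ∀ g, α g (d : A) = d := d.2
  set y := (d : A) * (z * star z) * d with hy
  have hy0 : 0 ≤ y := by
    have := star_right_conjugate_nonneg (mul_star_self_nonneg z) (d : A)
    rwa [hdsa] at this
  have hysa : star y = y := (IsSelfAdjoint.of_nonneg hy0).star_eq
  set l := cutDown y η
  have hl0 : 0 ≤ l := cutDown_nonneg y η
  have hlsa : star l = l := (IsSelfAdjoint.of_nonneg hl0).star_eq
  have hl : 0 < ‖l‖ := by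
    have h1 := norm_sub_cutDown_le hy0 hη.le
    have h2 := norm_sub_norm_le y l
    have h3 : 1 / (16 * n ^ 2) = η + η := by rw [hη_def]; field_simp; norm_num
    have : ‖y - l‖ ≤ η := h1
    linarith
  set x := (‖l‖ * ‖l‖)⁻¹ • (l * l) with hx
  have hll0 : 0 ≤ l * l := by simpa [hlsa] using star_mul_self_nonneg l
  -- Where `(t-η)₊` is nonzero, `t ≥ η`: this is the diagonal lower bound, and the reason `x` is
  -- built from `l` rather than from `y`.
  have hlly : (η ^ 2) • (l * l) ≤ l * (y * y) * l := by
    have hid : cfcₙ (fun t : ℝ => t) y = y := cfcₙ_id' ℝ y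
    have hc : Continuous (fun t : ℝ => max (t - η) 0) := by fun_prop
    have h0 : (fun t : ℝ => max (t - η) 0) 0 = 0 := by simp [hη.le]
    have e1 : (η ^ 2) • (l * l) = cfcₙ (fun t : ℝ => η ^ 2 • (max (t - η) 0 * max (t - η) 0)) y := by
      rw [cfcₙ_smul (η ^ 2) (fun t : ℝ => max (t - η) 0 * max (t - η) 0) y
        (by fun_prop) (by simp [hη.le]), cfcₙ_mul _ _ y hc.continuousOn h0 hc.continuousOn h0]
      rfl
    have e2 : l * (y * y) * l
        = cfcₙ (fun t : ℝ => max (t - η) 0 * (t * t) * max (t - η) 0) y := by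
      rw [cfcₙ_mul (fun t : ℝ => max (t - η) 0 * (t * t)) _ y (by fun_prop) (by simp)
        hc.continuousOn h0, cfcₙ_mul (fun t : ℝ => max (t - η) 0) (fun t : ℝ => t * t) y
        hc.continuousOn h0 (by fun_prop) (by simp), cfcₙ_mul (fun t : ℝ => t) (fun t : ℝ => t) y
        (by fun_prop) (by simp) (by fun_prop) (by simp), hid]
      rfl
    rw [e1, e2]
    refine cfcₙ_mono (fun t _ => ?_) (by fun_prop) (by fun_prop) (by simp [hη.le]) (by simp)
    rw [smul_eq_mul]
    rcases le_total t η with h | h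
    · rw [max_eq_right (by linarith)]; simp
    · have h1 : η ^ 2 ≤ t * t := by nlinarith
      have h2 := mul_le_mul_of_nonneg_right h1 (mul_self_nonneg (max (t - η) 0))
      linarith
  refine ⟨x, by positivity, ?_, fun r hr => ?_⟩
  · have : ‖l * l‖ = ‖l‖ * ‖l‖ := by
      have := CStarRing.norm_star_mul_self (x := l)
      rwa [hlsa] at this
    rw [hx, norm_smul, this, norm_inv, norm_mul, norm_norm]
    field_simp
  obtain ⟨v, hv⟩ := hr
  set c : ℝ := (‖l‖ * ‖l‖)⁻¹ with hc_def
  have hc : 0 < c := by positivity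
  -- the averages of `v k x (v k)*`
  set s : ℕ → A := fun k => n⁻¹ • ∑ g, α g (v k * x * star (v k)) with hs
  have hlim : Tendsto s atTop (𝓝 (r : A)) := by
    have h1 : Tendsto s atTop (𝓝 (n⁻¹ • ∑ g, α g (r : A))) := by
      refine Tendsto.const_smul (tendsto_finsetSum _ fun g _ => ?_) _
      exact ((StarAlgEquiv.isometry (α g)).continuous.tendsto _).comp hv
    have h2 : n⁻¹ • ∑ g, α g (r : A) = r := by
      have : ∀ g, α g (r : A) = r := r.2
      simp only [this, Finset.sum_const, Finset.card_univ]
      rw [← Nat.cast_smul_eq_nsmul ℝ, smul_smul, inv_mul_cancel₀ (by positivity), one_smul]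
    rwa [h2] at h1
  have hsfix : ∀ k, s k ∈ fixedPointAlgebra α := fun k g => by
    have h1 : (n⁻¹ : ℝ) • ∑ g, α g (v k * x * star (v k))
        = ((n⁻¹ : ℝ) : ℂ) • ∑ g, α g (v k * x * star (v k)) := (Complex.coe_smul _ _).symm
    rw [hs]
    simp only [h1, map_smul, sum_mem_fixedPointAlgebra α _ g]
  have hlim' : Tendsto (fun k => (⟨s k, hsfix k⟩ : fixedPointAlgebra α)) atTop (𝓝 r) :=
    tendsto_subtype_rng.2 hlim
  refine CuntzSubeq.of_tendsto hlim' fun k => ?_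
  have hx0 : 0 ≤ x := by positivity
  have hs0 : 0 ≤ s k := by
    have : ∀ g, 0 ≤ α g (v k * x * star (v k)) := fun g =>
      map_nonneg (α g) (star_right_conjugate_nonneg hx0 _)
    have := Finset.sum_nonneg fun g (_ : g ∈ Finset.univ) => this g
    positivity
  -- Invariance of `d` lets the last factor of `y` leave the sum, so `∑ α_g(v l y) = T d` with `T`
  -- invariant.
  set T := ∑ g, α g (v k * l * (d * (z * star z)))
  have hTfix : T ∈ fixedPointAlgebra α := sum_mem_fixedPointAlgebra α _
  have hW : ∑ g, α g (v k * l) * α g y = T * d := by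
    rw [Finset.sum_mul]
    refine Finset.sum_congr rfl fun g _ => ?_
    simp only [hy, map_mul, hdfix, mul_assoc]
  have hmain := smul_sum_mul_star_le (fun g => α g (v k * l)) (fun g => α g y) (η := η ^ 2) hδ
    (fun g => by
      have h1 := star_right_conjugate_le_conjugate hlly (v k)
      have h2 := OrderHomClass.mono (α g) h1
      have h3 : v k * (η ^ 2 • (l * l)) * star (v k)
          = ((η ^ 2 : ℝ) : ℂ) • ((v k * l) * star (v k * l)) := by
        rw [star_mul, hlsa, Complex.coe_smul]
        simp only [mul_smul_comm, smul_mul_assoc, mul_assoc]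
      rw [h3, map_smul, Complex.coe_smul] at h2
      simp only [← map_star, ← map_mul]
      rw [map_mul (α g) (v k * l)] at h2 ⊢
      refine h2.trans (le_of_eq ?_)
      simp only [star_mul, hlsa, hysa, mul_assoc])
    (fun g h hgh => by
      rw [← map_star, hysa]
      exact hz2 g h hgh)
  rw [hW] at hmain
  have hconst : η ^ 2 - (Fintype.card G : ℝ) * δ = η ^ 2 / 2 := by
    change η ^ 2 - n * (η ^ 2 / (2 * n)) = η ^ 2 / 2
    field_simp
    norm_num
  rw [hconst] at hmain
  set κ : ℝ := n⁻¹ * c / (η ^ 2 / 2) with hκ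
  have hκ0 : 0 < κ := by positivity
  have hsk : s k = κ • ((η ^ 2 / 2) • ∑ g, α g (v k * l) * star (α g (v k * l))) := by
    rw [smul_smul, hκ, div_mul_cancel₀ _ (by positivity), mul_smul, Finset.smul_sum]
    refine congrArg (n⁻¹ • ·) ?_
    refine Finset.sum_congr rfl fun g _ => ?_
    rw [← map_star, ← map_mul, ← Complex.coe_smul, ← map_smul, Complex.coe_smul, hx, star_mul, hlsa]
    simp only [mul_smul_comm, smul_mul_assoc, mul_assoc]
  have hle : s k ≤ κ • (T * d * star (T * d)) := by
    rw [hsk]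
    gcongr
  let T' : fixedPointAlgebra α := ((√κ : ℝ) : ℂ) • ⟨T, hTfix⟩
  have hT' : ((T' * (d * d) * star T' : fixedPointAlgebra α) : A) = κ • (T * d * star (T * d)) := by
    change ((√κ : ℝ) : ℂ) • T * ((d : A) * d) * star (((√κ : ℝ) : ℂ) • T) = _
    rw [Complex.coe_smul, star_smul, star_mul, hdsa, star_trivial]
    simp only [mul_smul_comm, smul_mul_assoc, smul_smul, mul_assoc, Real.mul_self_sqrt hκ0.le]
  refine CuntzSubeq.trans (CuntzSubeq.of_le (q := T' * (d * d) * star T') hs0 ?_)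
    (cuntzSubeq_conjugate _ _)
  change s k ≤ ((T' * (d * d) * star T' : fixedPointAlgebra α) : A)
  rw [hT']
  exact hle

end Rokhlin

/-! ### Splitting off a piece of `b` near zero -/

section Main

variable {A : Type*} [NonUnitalCStarAlgebra A]

theorem CuntzSubeq.smul_left {a b : A} (h : CuntzSubeq a b) {r : ℝ} (hr : 0 ≤ r) :
    CuntzSubeq (r • a) b := by
  obtain ⟨w, hw⟩ := h
  refine ⟨fun n => √r • w n, ?_⟩
  have : ∀ n, (√r • w n) * b * star (√r • w n) = r • (w n * b * star (w n)) := fun n => by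
    simp only [star_smul, star_trivial, smul_mul_assoc, mul_smul_comm, smul_smul,
      Real.mul_self_sqrt hr]
  simpa only [this] using hw.const_smul r

variable [PartialOrder A] [StarOrderedRing A]

theorem exists_mem_quasispectrum_of_accPt {b : A} (hb : 0 ≤ b)
    (hlim : AccPt (0 : ℂ) (𝓟 (quasispectrum ℂ b))) {δ : ℝ} (hδ : 0 < δ) :
    ∃ t ∈ quasispectrum ℝ b, 0 < t ∧ t < δ := by
  obtain ⟨y, ⟨hyδ, hy⟩, hy0⟩ := accPt_iff_nhds.1 hlim _ (Metric.ball_mem_nhds 0 hδ)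
  have hres := (IsSelfAdjoint.of_nonneg hb).quasispectrumRestricts
  rw [← hres.algebraMap_image] at hy
  obtain ⟨t, ht, rfl⟩ := hy
  have ht0 : t ≠ 0 := by
    rintro rfl
    exact hy0 (map_zero _)
  have := quasispectrum_nonneg_of_nonneg b hb t ht
  refine ⟨t, ht, lt_of_le_of_ne this (Ne.symm ht0), ?_⟩
  rw [mem_ball_zero_iff, norm_algebraMap', Real.norm_eq_abs] at hyδ
  exact (le_abs_self t).trans_lt hyδ

/-- `φ` vanishes up to `δ` and is `1` from `2δ` on, while `κ` lives on `(0, δ)`, where `sp(b)` has a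
point. All pieces are functions of `b`, hence invariant when `b` is. -/
theorem exists_orthogonal_splitting {b : A} (hb : 0 ≤ b)
    (hlim : AccPt (0 : ℂ) (𝓟 (quasispectrum ℂ b))) {δ : ℝ} (hδ : 0 < δ) :
    ∃ φ κ ψ : ℝ → ℝ, 0 ≤ cfcₙ ψ b ∧ ‖cfcₙ ψ b‖ = 1 ∧
      cfcₙ ψ b * cfcₙ ψ b = cfcₙ κ b * b * cfcₙ κ b ∧
      ‖b - cfcₙ φ b * b * cfcₙ φ b‖ ≤ 2 * δ ∧
      cfcₙ φ b * b * cfcₙ κ b = 0 ∧ cfcₙ κ b * b * cfcₙ φ b = 0 := by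
  have hσ : ∀ t ∈ quasispectrum ℝ b, 0 ≤ t := quasispectrum_nonneg_of_nonneg b hb
  have hid : cfcₙ (fun t : ℝ => t) b = b := cfcₙ_id' ℝ b
  let φ : ℝ → ℝ := fun t => min 1 (max (t - δ) 0 / δ)
  let κ₀ : ℝ → ℝ := fun t => max 0 (min t (δ - t))
  have hφc : Continuous φ := by
    have : Continuous fun t : ℝ => max (t - δ) 0 / δ := by fun_prop
    exact continuous_const.min this
  have hφ0 : φ 0 = 0 := by simp [φ, hδ.le]
  have hκc : Continuous κ₀ := by fun_prop
  have hκ0 : κ₀ 0 = 0 := by simp [κ₀, hδ.le]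
  have hκnn : ∀ t, 0 ≤ κ₀ t := fun t => le_max_left _ _
  -- The square root gives `ψ₀² = κ₀² t`; dividing by `N` normalises `ψ(b)`.
  let ψ₀ : ℝ → ℝ := fun t => κ₀ t * √t
  have hψc : Continuous ψ₀ := hκc.mul Real.continuous_sqrt
  have hψ0 : ψ₀ 0 = 0 := by simp [ψ₀]
  set N := ‖cfcₙ ψ₀ b‖
  have hN : 0 < N := by
    obtain ⟨t, ht, ht0, htδ⟩ := exists_mem_quasispectrum_of_accPt hb hlim hδ
    have h1 := norm_apply_le_norm_cfcₙ ψ₀ b ht hψc.continuousOn hψ0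
    have h2 : 0 < ψ₀ t :=
      mul_pos (lt_max_of_lt_right (lt_min ht0 (by linarith))) (Real.sqrt_pos.2 ht0)
    exact (h2.trans_le (Real.le_norm_self _)).trans_le h1
  let κ : ℝ → ℝ := fun t => N⁻¹ * κ₀ t
  let ψ : ℝ → ℝ := fun t => N⁻¹ * ψ₀ t
  have hκc' : Continuous κ := continuous_const.mul hκc
  have hκ0' : κ 0 = 0 := by simp [κ, hκ0]
  have hψc' : Continuous ψ := continuous_const.mul hψc
  have hψ0' : ψ 0 = 0 := by simp [ψ, hψ0]
  have hsandwich : ∀ {p q : ℝ → ℝ}, Continuous p → p 0 = 0 → Continuous q → q 0 = 0 →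
      cfcₙ p b * b * cfcₙ q b = cfcₙ (fun t => p t * t * q t) b := by
    intro p q hp hp0 hq hq0
    rw [cfcₙ_mul (fun t => p t * t) q b (hp.mul continuous_id).continuousOn (by simp)
      hq.continuousOn hq0, cfcₙ_mul p (fun t => t) b hp.continuousOn hp0
      continuousOn_id (by simp), hid]
  have hφκ : ∀ t, φ t * t * κ t = 0 := by
    intro t
    rcases le_total t δ with h | h
    · have : φ t = 0 := by
        simp only [φ, max_eq_right (sub_nonpos.2 h), zero_div]
        exact min_eq_right zero_le_one
      rw [this, zero_mul, zero_mul]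
    · have : κ₀ t = 0 := max_eq_left ((min_le_right _ _).trans (sub_nonpos.2 h))
      simp only [κ, this, mul_zero]
  refine ⟨φ, κ, ψ, ?_, ?_, ?_, ?_, ?_, ?_⟩
  · exact cfcₙ_nonneg fun t _ =>
      mul_nonneg (inv_nonneg.2 hN.le) (mul_nonneg (hκnn t) (Real.sqrt_nonneg t))
  · have : cfcₙ ψ b = N⁻¹ • cfcₙ ψ₀ b := cfcₙ_const_mul N⁻¹ ψ₀ b hψc.continuousOn hψ0
    rw [this, norm_smul, norm_inv, Real.norm_of_nonneg hN.le]
    exact inv_mul_cancel₀ hN.ne'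
  · rw [hsandwich hκc' hκ0' hκc' hκ0', ← cfcₙ_mul ψ ψ b hψc'.continuousOn hψ0'
      hψc'.continuousOn hψ0']
    refine cfcₙ_congr fun t ht => ?_
    have := Real.mul_self_sqrt (hσ t ht)
    simp only [ψ, κ, ψ₀]
    linear_combination (N⁻¹ * κ₀ t) ^ 2 * this
  · rw [hsandwich hφc hφ0 hφc hφ0]
    have : b - cfcₙ (fun t => φ t * t * φ t) b = cfcₙ (fun t => t - φ t * t * φ t) b := by
      rw [cfcₙ_sub (fun t : ℝ => t) (fun t => φ t * t * φ t) b continuousOn_id (by simp)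
        ((hφc.mul continuous_id).mul hφc).continuousOn (by simp), hid]
    rw [this]
    refine norm_cfcₙ_le fun t ht => ?_
    have ht0 := hσ t ht
    have h1 : φ t ≤ 1 := min_le_left _ _
    have h0 : 0 ≤ φ t := le_min zero_le_one (div_nonneg (le_max_right _ _) hδ.le)
    have h2 : φ t * φ t ≤ 1 := mul_le_one₀ h1 h0 h1
    have h3 : φ t * t * φ t = φ t * φ t * t := by ring
    rw [Real.norm_of_nonneg (by rw [h3]; nlinarith)]
    rcases le_total t (2 * δ) with h | h
    · have : 0 ≤ φ t * t * φ t := by positivity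
      linarith
    · have : φ t = 1 := by
        refine min_eq_left ?_
        rw [le_div_iff₀ hδ, one_mul]
        exact le_max_of_le_left (by linarith)
      rw [this]
      linarith
  · rw [hsandwich hφc hφ0 hκc' hκ0']
    simp only [hφκ]
    exact cfcₙ_const_zero ℝ b
  · rw [hsandwich hκc' hκ0' hφc hφ0]
    have : ∀ t, κ t * t * φ t = 0 := fun t => by rw [← hφκ t]; ring
    simp only [this]
    exact cfcₙ_const_zero ℝ b

omit [PartialOrder A] [StarOrderedRing A] in
/-- One entry of the compression of a matrix by an almost central, almost equivariant tower. -/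
theorem norm_tower_entry_sub_le {f f' k k' c S a : A} {C ε τ : ℝ} (hC : 1 ≤ C) (hε : 0 ≤ ε)
    (hτ : 0 ≤ τ) (hf : ‖f‖ ≤ 1) (hf' : ‖f'‖ ≤ 1) (hk' : ‖k'‖ ≤ 1)
    (hkf : ‖k - f‖ ≤ ε) (hkf' : ‖k' - f'‖ ≤ ε) (hc : ‖c‖ ≤ C) (hS : ‖S‖ ≤ C)
    (hcf : ‖c * f - f * c‖ ≤ ε) (hSf : ‖S * f - f * S‖ ≤ ε) (ha : S * S = a)
    (h : f * f' = 0 ∨ (f = f' ∧ ‖c - a‖ ≤ τ)) :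
    ‖k * c * k' - S * f * (f' * S)‖ ≤ 5 * C * ε + τ := by
  have h1 : ‖k * c * k' - f * c * f'‖ ≤ 2 * C * ε := by
    have e : k * c * k' - f * c * f' = (k - f) * c * k' + f * c * (k' - f') := by noncomm_ring
    have n1 : ‖(k - f) * c * k'‖ ≤ ε * C * 1 :=
      (norm_mul₃_le).trans (by gcongr)
    have n2 : ‖f * c * (k' - f')‖ ≤ 1 * C * ε :=
      (norm_mul₃_le).trans (by gcongr)
    rw [e]
    linarith [norm_add_le ((k - f) * c * k') (f * c * (k' - f'))]
  rcases h with h | ⟨rfl, h⟩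
  · have h2 : ‖f * c * f'‖ ≤ ε := by
      -- Orthogonality turns an off-diagonal entry into a commutator.
      have e : f * c * f' = -((c * f - f * c) * f') := by
        rw [sub_mul, mul_assoc c f f', h]; simp
      rw [e, norm_neg]
      calc _ ≤ _ := norm_mul_le _ _
        _ ≤ ε * 1 := by gcongr
        _ = ε := mul_one ε
    have h3 : S * f * (f' * S) = 0 := by
      rw [mul_assoc, ← mul_assoc f, h]; simp
    rw [h3, sub_zero]
    have h4 := norm_add_le (k * c * k' - f * c * f') (f * c * f')
    rw [sub_add_cancel] at h4
    nlinarith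
  · have h2 : ‖f * c * f - f * a * f‖ ≤ τ := by
      have e : f * c * f - f * a * f = f * (c - a) * f := by noncomm_ring
      rw [e]
      calc _ ≤ _ := norm_mul₃_le
        _ ≤ 1 * τ * 1 := by gcongr
        _ = τ := by ring
    have h3 : ‖f * a * f - S * f * (f * S)‖ ≤ 2 * C * ε := by
      have e : f * a * f - S * f * (f * S)
          = f * S * (S * f - f * S) - (S * f - f * S) * f * S := by
        rw [← ha]; noncomm_ring
      have n1 : ‖f * S * (S * f - f * S)‖ ≤ 1 * C * ε := norm_mul₃_le.trans (by gcongr)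
      have n2 : ‖(S * f - f * S) * f * S‖ ≤ ε * 1 * C := norm_mul₃_le.trans (by gcongr)
      rw [e]
      linarith [norm_sub_le (f * S * (S * f - f * S)) ((S * f - f * S) * f * S)]
    have h4 := norm_add₃_le (a := k * c * k' - f * c * f) (b := f * c * f - f * a * f)
      (c := f * a * f - S * f * (f * S))
    have e : k * c * k' - f * c * f + (f * c * f - f * a * f) + (f * a * f - S * f * (f * S))
        = k * c * k' - S * f * (f * S) := by abel
    rw [e] at h4
    nlinarith

omit [PartialOrder A] [StarOrderedRing A] in
theorem norm_sum_sum_sub_le {ι : Type*} [Fintype ι] {p q : ι → ι → A} {K : ℝ}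
    (h : ∀ i j, ‖p i j - q i j‖ ≤ K) :
    ‖∑ i, ∑ j, p i j - ∑ i, ∑ j, q i j‖ ≤ (Fintype.card ι : ℝ) ^ 2 * K := by
  simp only [← Finset.sum_sub_distrib]
  refine (norm_sum_le _ _).trans ((Finset.sum_le_sum fun g _ => (norm_sum_le _ _).trans
    (Finset.sum_le_sum fun k _ => h g k)).trans_eq ?_)
  simp only [Finset.sum_const, Finset.card_univ, nsmul_eq_mul]
  ring

/-! ### Averaging along the tower and absorbing the remainder -/

variable {G : Type*} [Group G] [Fintype G]

set_option maxHeartbeats 600000 in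
/-- The invariant part of the comparison, up to an arbitrarily small error. -/
theorem WeakTracialRokhlin.exists_le_conjugate_add {α : G →* (A ≃⋆ₐ[ℂ] A)}
    (hα : WeakTracialRokhlin α) {a b : fixedPointAlgebra α} (ha : 0 ≤ a) (hb : 0 ≤ b)
    (hlim : AccPt (0 : ℂ) (𝓟 (quasispectrum ℂ (b : A)))) (hab : CuntzSubeq (a : A) (b : A))
    {σ : ℝ} (hσ : 0 < σ) :
    ∃ W e : fixedPointAlgebra α, a ≤ W * b * star W + e ∧ ‖e‖ ≤ σ := by
  classical
  have ha' : 0 ≤ (a : A) := ha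
  have hb' : 0 ≤ (b : A) := hb
  set n : ℝ := (Fintype.card G : ℝ) with hn_def
  have hn : 1 ≤ n := Nat.one_le_cast.2 Fintype.card_pos
  -- The `n²` entries of the compression contribute `n²τ = σ/2`; the other half of `σ` is left for
  -- the tower errors.
  set τ : ℝ := σ / (2 * n ^ 2) with hτ_def
  have hτ : 0 < τ := by positivity
  obtain ⟨v, hv⟩ := cuntzSubeq_iff_forall_norm_le.1 hab (τ / 2) (by positivity)
  -- Chosen after `v`, so that replacing `b` by `b₁` costs `2δ‖v‖² ≤ τ/2`.
  set δ : ℝ := τ / (4 * (‖v‖ ^ 2 + 1))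
  have hδ : 0 < δ := by positivity
  obtain ⟨φ, κ, ψ, hd0, hd1, hdd, hφb, hφκ, hκφ⟩ := exists_orthogonal_splitting hb' hlim hδ
  let Φ : fixedPointAlgebra α := ⟨cfcₙ φ (b : A), cfcₙ_mem_fixedPointAlgebra α φ b.2⟩
  let K : fixedPointAlgebra α := ⟨cfcₙ κ (b : A), cfcₙ_mem_fixedPointAlgebra α κ b.2⟩
  let d : fixedPointAlgebra α := ⟨cfcₙ ψ (b : A), cfcₙ_mem_fixedPointAlgebra α ψ b.2⟩
  have hΦsa : star Φ = Φ := Subtype.ext (IsSelfAdjoint.cfcₙ (f := φ) (a := (b : A)))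
  have hKsa : star K = K := Subtype.ext (IsSelfAdjoint.cfcₙ (f := κ) (a := (b : A)))
  have hdd' : d * d = K * b * K := Subtype.ext hdd
  have hΦK : Φ * b * K = 0 := Subtype.ext hφκ
  have hKΦ : K * b * Φ = 0 := Subtype.ext hκφ
  obtain ⟨x, hx0, hx1, hx⟩ := hα.exists_forall_cuntzSubeq d hd0 hd1
  let b₁ : fixedPointAlgebra α := Φ * b * Φ
  have hvb : ‖v * b₁ * star v - a‖ ≤ τ := by
    have h1 : ‖v * ((b : A) - b₁) * star v‖ ≤ τ / 2 := by
      calc _ ≤ ‖v‖ * ‖(b : A) - b₁‖ * ‖star v‖ := norm_mul₃_le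
        _ ≤ ‖v‖ * (2 * δ) * ‖v‖ := by rw [norm_star]; gcongr; exact hφb
        _ = (τ / 2) * (‖v‖ ^ 2 / (‖v‖ ^ 2 + 1)) := by simp only [δ]; field_simp; norm_num
        _ ≤ (τ / 2) * 1 := by
          gcongr
          rw [div_le_one (by positivity)]
          linarith
        _ = τ / 2 := mul_one _
    have h2 : v * b₁ * star v - a
        = -((a - v * b * star v) + v * ((b : A) - b₁) * star v) := by noncomm_ring
    rw [h2, norm_neg]
    linarith [norm_add_le ((a : A) - v * b * star v) (v * ((b : A) - b₁) * star v)]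
  set S := CFC.sqrt (a : A) with hS
  have hSS : S * S = a := CFC.sqrt_mul_sqrt_self (a : A)
  have hS0 : 0 ≤ S := CFC.sqrt_nonneg _
  have hSsa : star S = S := (IsSelfAdjoint.of_nonneg hS0).star_eq
  have hSfix : S ∈ fixedPointAlgebra α := by
    rw [hS, CFC.sqrt_eq_real_sqrt (a : A)]
    exact cfcₙ_mem_fixedPointAlgebra α _ a.2
  set c : G → G → A := fun g h => α g v * b₁ * star (α h v)
  obtain ⟨C, hC1, hSC, hcC⟩ : ∃ C : ℝ, 1 ≤ C ∧ ‖S‖ ≤ C ∧ ∀ g h, ‖c g h‖ ≤ C := by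
    refine ⟨1 + ‖S‖ + ∑ g, ∑ h, ‖c g h‖, ?_, ?_, fun g h => ?_⟩
    · have : 0 ≤ ∑ g, ∑ h, ‖c g h‖ := by positivity
      linarith [norm_nonneg S]
    · have : 0 ≤ ∑ g, ∑ h, ‖c g h‖ := by positivity
      linarith
    · have h1 := Finset.single_le_sum (f := fun h => ‖c g h‖) (fun _ _ => norm_nonneg _)
        (Finset.mem_univ h)
      have h2 := Finset.single_le_sum (f := fun g => ∑ h, ‖c g h‖) (fun _ _ => by positivity)
        (Finset.mem_univ g)
      have h3 : ‖c g h‖ ≤ ∑ g, ∑ h, ‖c g h‖ := h1.trans h2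
      linarith [norm_nonneg S]
  -- The tower errors total `5n²Cε + 6n²C²ε + 4ε ≤ 15σ/30`.
  set ε : ℝ := σ / (30 * n ^ 2 * C ^ 2) with hε_def
  have hε : 0 < ε := by positivity
  obtain ⟨f, hf1, hf2, hf3, hf4, hf5, -⟩ := hα ε hε
    (insert S (Finset.univ.image fun gh : G × G => c gh.1 gh.2)) x S hx0 hS0 hx1
  have hfsa : ∀ g, star (f g) = f g := fun g => (IsSelfAdjoint.of_nonneg (hf1 g).1).star_eq
  set F := ∑ g, f g with hF
  have hFsa : star F = F := by simp only [hF, star_sum, hfsa]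
  -- `F` is only almost invariant; `F₁` is an invariant element within `nε` of it.
  let F₁ : fixedPointAlgebra α := ⟨∑ g, α g (f 1), sum_mem_fixedPointAlgebra α _⟩
  let S₁ : fixedPointAlgebra α := ⟨S, hSfix⟩
  let w : fixedPointAlgebra α := ⟨∑ g, α g (f 1 * v), sum_mem_fixedPointAlgebra α _⟩
  have hα1 : ∀ g, ‖α g (f 1)‖ ≤ 1 := fun g => by
    rw [norm_starAlgEquiv_apply]; exact (hf1 1).2
  have hα2 : ∀ g, ‖α g (f 1) - f g‖ ≤ ε := fun g => by simpa using (hf4 g 1).le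
  have hα3 : ∀ g, star (α g (f 1)) = α g (f 1) := fun g => by rw [← map_star, hfsa]
  -- the compressed part
  have hmain : ‖((w * b₁ * star w : fixedPointAlgebra α) : A) - S * F * (F * S)‖
      ≤ n ^ 2 * (5 * C * ε + τ) := by
    have e1 : ((w * b₁ * star w : fixedPointAlgebra α) : A)
        = ∑ g, ∑ h, α g (f 1) * c g h * α h (f 1) := by
      change (∑ g, α g (f 1 * v)) * b₁ * star (∑ g, α g (f 1 * v)) = _
      rw [star_sum, Finset.sum_mul, Finset.sum_mul_sum]
      refine Finset.sum_congr rfl fun g _ => Finset.sum_congr rfl fun h _ => ?_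
      simp only [map_mul, star_mul, hα3, c, mul_assoc]
    have e2 : S * F * (F * S) = ∑ g, ∑ h, S * f g * (f h * S) := by
      rw [hF, Finset.mul_sum, Finset.sum_mul Finset.univ f S, Finset.sum_mul_sum]
    rw [e1, e2]
    refine norm_sum_sum_sub_le fun g h => ?_
    refine norm_tower_entry_sub_le hC1 hε.le hτ.le (hf1 g).2 (hf1 h).2 (hα1 h) (hα2 g) (hα2 h)
      (hcC g h) hSC (hf3 g _ ?_).le (hf3 g _ (Finset.mem_insert_self _ _)).le hSS ?_
    · exact Finset.mem_insert_of_mem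
        (Finset.mem_image.2 ⟨(g, h), Finset.mem_univ _, rfl⟩)
    · by_cases hgh : g = h
      · subst hgh
        refine Or.inr ⟨rfl, ?_⟩
        have hb₁ : α g (b₁ : A) = b₁ := b₁.2 g
        have haα : α g (a : A) = a := a.2 g
        have : c g g - a = α g (v * b₁ * star v - a) := by
          simp only [c, map_sub, map_mul, map_star, haα]
          rw [hb₁]
        rw [this, norm_starAlgEquiv_apply]
        exact hvb
      · exact Or.inl (hf2 g h hgh)
  have hFn : ‖F‖ ≤ n := by
    refine (norm_sum_le _ _).trans ((Finset.sum_le_sum fun g _ => (hf1 g).2).trans_eq ?_)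
    simp [hn_def]
  have hF₁n : ‖(F₁ : A)‖ ≤ n := by
    refine (norm_sum_le _ _).trans ((Finset.sum_le_sum fun g _ => hα1 g).trans_eq ?_)
    simp [hn_def]
  have hFF₁ : ‖(F₁ : A) - F‖ ≤ n * ε := by
    change ‖∑ g, α g (f 1) - ∑ g, f g‖ ≤ _
    rw [← Finset.sum_sub_distrib]
    refine (norm_sum_le _ _).trans ((Finset.sum_le_sum fun g _ => hα2 g).trans_eq ?_)
    simp [hn_def]
  have hdiff : ‖S * F * (F * S) - S * F₁ * (F₁ * S)‖ ≤ 2 * n ^ 2 * C ^ 2 * ε := by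
    have e : S * F * (F * S) - S * F₁ * (F₁ * S)
        = -(S * ((F₁ - F) * F + F₁ * (F₁ - F)) * S) := by noncomm_ring
    have n1 : ‖((F₁ : A) - F) * F‖ ≤ (n * ε) * n := (norm_mul_le _ _).trans (by gcongr)
    have n2 : ‖(F₁ : A) * (F₁ - F)‖ ≤ n * (n * ε) := (norm_mul_le _ _).trans (by gcongr)
    have n3 := norm_add_le (((F₁ : A) - F) * F) ((F₁ : A) * (F₁ - F))
    rw [e, norm_neg]
    calc _ ≤ _ := norm_mul₃_le
      _ ≤ C * (2 * n ^ 2 * ε) * C := by gcongr; linarith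
      _ = _ := by ring
  -- the remainder
  let R : fixedPointAlgebra α := a - S₁ * F₁ * (F₁ * S₁)
  have hF₁sa : star (F₁ : A) = F₁ := by
    change star (∑ g, α g (f 1)) = ∑ g, α g (f 1)
    simp only [star_sum, hα3]
  have hRsa : IsSelfAdjoint (R : A) := by
    change star ((a : A) - S * F₁ * (F₁ * S)) = (a : A) - S * F₁ * (F₁ * S)
    rw [star_sub, (IsSelfAdjoint.of_nonneg ha').star_eq, star_mul, star_mul, star_mul, hF₁sa, hSsa]
  set r₀ := S * S - S * F * S with hr₀
  have hr₀sa : IsSelfAdjoint r₀ := by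
    change star (S * S - S * F * S) = S * S - S * F * S
    simp only [star_sub, star_mul, hSsa, hFsa, mul_assoc]
  set s : ℝ := 2 * ε + 2 * n ^ 2 * C ^ 2 * ε with hs_def
  have hs : 0 < s := by positivity
  set m := cfcₙ (fun t : ℝ => max (min t ε) 0) r₀
  have hRle : (R : A) ≤ (2 : ℝ) • cutDown r₀ ε
      + ((2 : ℝ) • m + (S * F * (F * S) - S * F₁ * (F₁ * S))) := by
    have h1 : r₀ ≤ cutDown r₀ ε + m := le_cutDown_add_cfcₙ_clamp hr₀sa hε.le
    have h2 : (2 : ℝ) • r₀ ≤ (2 : ℝ) • (cutDown r₀ ε + m) := by gcongr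
    have h3 := mul_star_self_nonneg (S - S * F)
    -- This is `1 - F² ≤ 2(1 - F)` conjugated by `S`; it brings in `r₀`, the element that condition
    -- (3) controls.
    have h4 : (S - S * F) * star (S - S * F) = (2 : ℝ) • r₀ - (a - S * F * (F * S)) := by
      rw [star_sub, star_mul, hSsa, hFsa, hr₀, ← hSS, two_smul]
      noncomm_ring
    rw [h4, sub_nonneg] at h3
    have h5 : (R : A) = (a - S * F * (F * S)) + (S * F * (F * S) - S * F₁ * (F₁ * S)) := by
      change (a : A) - S * F₁ * (F₁ * S) = _
      abel
    rw [h5, ← add_assoc, ← smul_add]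
    gcongr
    exact h3.trans h2
  have herr : ‖(2 : ℝ) • m + (S * F * (F * S) - S * F₁ * (F₁ * S))‖ ≤ s := by
    have h1 : ‖(2 : ℝ) • m‖ ≤ 2 * ε := by
      rw [norm_smul, Real.norm_two]
      gcongr
      exact norm_cfcₙ_clamp_le r₀ hε.le
    exact (norm_add_le _ _).trans (add_le_add h1 hdiff)
  have hcut0 : 0 ≤ (2 : ℝ) • cutDown r₀ ε := by
    have := cutDown_nonneg r₀ ε
    positivity
  have hrx : CuntzSubeq (cutDown (R : A) s) x :=
    (cutDown_cuntzSubeq_of_le_add hRsa hcut0 hRle herr).trans (hf5.smul_left zero_le_two)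
  let r : fixedPointAlgebra α := ⟨cutDown (R : A) s, cfcₙ_mem_fixedPointAlgebra α _ R.2⟩
  let M : fixedPointAlgebra α :=
    ⟨cfcₙ (fun t : ℝ => max (min t s) 0) (R : A), cfcₙ_mem_fixedPointAlgebra α _ R.2⟩
  obtain ⟨u, hu⟩ := cuntzSubeq_iff_forall_norm_le.1 (hx r hrx) s hs
  have hRrM : R ≤ r + M := le_cutDown_add_cfcₙ_clamp hRsa hs.le
  -- assembling
  let e : fixedPointAlgebra α :=
    -(w * b₁ * star w - S₁ * F₁ * (F₁ * S₁)) + M + (r - u * (d * d) * star u)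
  refine ⟨w * Φ + u * K, e, ?_, ?_⟩
  -- Orthogonality of the two pieces of `b` kills the cross terms, so a single conjugating element
  -- combines both comparisons.
  · have hW : (w * Φ + u * K) * b * star (w * Φ + u * K)
        = w * b₁ * star w + u * (d * d) * star u := by
      rw [star_add, star_mul, star_mul, hΦsa, hKsa, hdd']
      have e1 : (w * Φ + u * K) * b * (Φ * star w + K * star u)
          = w * (Φ * b * Φ) * star w + w * (Φ * b * K) * star u + u * (K * b * Φ) * star w
            + u * (K * b * K) * star u := by noncomm_ring
      rw [e1, hΦK, hKΦ]
      simp [b₁]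
    have h1 : (w * Φ + u * K) * b * star (w * Φ + u * K) + e = (a - R) + (r + M) := by
      rw [hW]
      simp only [e, R]
      abel
    rw [h1]
    calc a = (a - R) + R := (sub_add_cancel _ _).symm
      _ ≤ (a - R) + (r + M) := add_le_add_right hRrM _
  · have h1 : ‖w * b₁ * star w - S₁ * F₁ * (F₁ * S₁)‖
        ≤ n ^ 2 * (5 * C * ε + τ) + 2 * n ^ 2 * C ^ 2 * ε := by
      have h2 : ((w * b₁ * star w - S₁ * F₁ * (F₁ * S₁) : fixedPointAlgebra α) : A)
          = (((w * b₁ * star w : fixedPointAlgebra α) : A) - S * F * (F * S))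
            + (S * F * (F * S) - S * F₁ * (F₁ * S)) := by
        rw [sub_add_sub_cancel]
        rfl
      change ‖((w * b₁ * star w - S₁ * F₁ * (F₁ * S₁) : fixedPointAlgebra α) : A)‖ ≤ _
      rw [h2]
      exact (norm_add_le _ _).trans (add_le_add hmain hdiff)
    have h2 : ‖M‖ ≤ s := norm_cfcₙ_clamp_le (R : A) hs.le
    have h3 : ‖e‖ ≤ (n ^ 2 * (5 * C * ε + τ) + 2 * n ^ 2 * C ^ 2 * ε) + s + s := by
      refine norm_add₃_le.trans ?_
      rw [norm_neg]
      exact add_le_add (add_le_add h1 h2) hu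
    refine h3.trans ?_
    have h4 : n ^ 2 * τ = σ / 2 := by rw [hτ_def]; field_simp
    have h5 : n ^ 2 * C ^ 2 * ε = σ / 30 := by rw [hε_def]; field_simp
    have h6 : n ^ 2 * C * ε ≤ σ / 30 := by
      rw [← h5]
      gcongr
      exact le_self_pow₀ hC1 two_ne_zero
    have h7 : ε ≤ σ / 30 := by
      rw [← h5]
      have : 1 ≤ n ^ 2 * C ^ 2 := one_le_mul_of_one_le_of_one_le (one_le_pow₀ hn) (one_le_pow₀ hC1)
      exact le_mul_of_one_le_left hε.le this
    calc _ = n ^ 2 * τ + 5 * (n ^ 2 * C * ε) + 6 * (n ^ 2 * C ^ 2 * ε) + 4 * ε := by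
          rw [hs_def]; ring
      _ ≤ σ := by rw [h4, h5]; linarith

end Main

theorem mainTheorem2 {A : Type*} [NonUnitalCStarAlgebra A] [PartialOrder A] [StarOrderedRing A]
    {G : Type*} [Group G] [Fintype G] (α : G →* (A ≃⋆ₐ[ℂ] A))
    (hsimple : IsSimpleCStarAlgebra A) (hinf : ¬ FiniteDimensional ℂ A)
    (hα : WeakTracialRokhlin α)
    (a b : fixedPointAlgebra α) (ha : 0 ≤ (a : A)) (hb : 0 ≤ (b : A))
    (hlim : AccPt (0 : ℂ) (𝓟 (quasispectrum ℂ (b : A)))) :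
    CuntzSubeq (a : A) (b : A) ↔ CuntzSubeq a b := by
  refine ⟨fun hab => ?_, CuntzSubeq.coe⟩
  have ha₁ : 0 ≤ a := ha
  have hb₁ : 0 ≤ b := hb
  -- It suffices to treat the cut-downs of `a`, each of which tolerates an error of its own size.
  have hlim' : Tendsto (fun k : ℕ => cutDown a (1 / ((k : ℝ) + 1))) atTop (𝓝 a) := by
    rw [tendsto_iff_norm_sub_tendsto_zero]
    refine squeeze_zero (fun _ => norm_nonneg _) (fun k => ?_)
      tendsto_one_div_add_atTop_nhds_zero_nat
    rw [norm_sub_rev]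
    exact norm_sub_cutDown_le ha₁ (by positivity)
  refine CuntzSubeq.of_tendsto hlim' fun k => ?_
  obtain ⟨W, e, hle, he⟩ := hα.exists_le_conjugate_add ha₁ hb₁ hlim hab
    (σ := 1 / ((k : ℝ) + 1)) (by positivity)
  exact (cutDown_cuntzSubeq_of_le_add (IsSelfAdjoint.of_nonneg ha₁)
    (star_right_conjugate_nonneg hb₁ W) hle he).trans (cuntzSubeq_conjugate W b)
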